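/- Let $n\ge 0$ be an integer, let $H:\mathbb R^n\to\mathbb R$ be continuous and let $u_0:\mathbb R^n\to\mathbb R$ be Bohr almost periodic, i.e. $u_0\in AP(\mathbb R^n)$, where $AP(\mathbb R^n)$ is the closure, in the uniform norm, of the trigonometric polynomials $\sum a_\lambda e^{2\pi i\lambda\cdot x}$ (finite sums, $\lambda\in\mathbb R^n$, $a_\lambda\in\mathbb C$). Let $u$ be the viscosity solution of the Cauchy problem $$u_t+H(\nabla_x u)=0 \text{ in } \Pi=(0,\infty)\times\mathbb R^n,\qquad u(0,x)=u_0(x);$$ that is, $u:[0,\infty)\times\mathbb R^n\to\mathbb R$ is continuous, it is bounded and uniformly continuous in every layer $[0,T)\times\mathbb R^n$, $T>0$, it satisfies $u(0,\cdot)=u_0$, and, for every $(t,x)\in\Pi$ and every $\varphi\in C^1(\Pi)$, one has $\varphi_t(t,x)+H(\nabla_x\varphi(t,x))\le 0$ if $u-\varphi$ has a local maximum at $(t,x)$, and $\varphi_t(t,x)+H(\nabla_x\varphi(t,x))\ge 0$ if $u-\varphi$ has a local minimum at $(t,x)$. (It is known that such a solution exists and is unique.) Then $u(t,\cdot)\in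 C([0,+\infty),AP(\mathbb R^n))$, i.e. $u(t,\cdot)\in AP(\mathbb R^n)$ for all $t\ge0$ and $t\mapsto u(t,\cdot)$ is continuous in the uniform norm. Moreover, for all $t>0$, $Sp(u(t,\cdot))\subset M_0$. Here the spectrum of $v\in AP(\mathbb R^n)$ is $$Sp(v)=\Big\{\lambda\in\mathbb R^n : \lim_{R\to+\infty}R^{-n}\int_{\{\max_i|x_i|\le R/2\}}v(x)e^{-2\pi i\lambda\cdot x}\,dx\neq0\Big\},$$ and $M_0$ is the smallest additive subgroup of $\mathbb R^n$ containing $Sp(u_0)$. -/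

import Mathlib

open Set Filter Topology MeasureTheory
open scoped NNReal BoundedContinuousFunction

namespace HamiltonJacobi

/-- The Euclidean space `ℝⁿ`. -/
abbrev Space (n : ℕ) : Type := EuclideanSpace ℝ (Fin n)

/-! ### Viscosity solutions -/

/-- The open half-space `Π = (0, ∞) × ℝⁿ`. -/
def halfSpace (n : ℕ) : Set (ℝ × Space n) := Ioi 0 ×ˢ univ

/-- The closed half-space `[0, ∞) × ℝⁿ`. -/
def closedHalfSpace (n : ℕ) : Set (ℝ × Space n) := Ici 0 ×ˢ univ

/-- The layer `[0, T) × ℝⁿ`. -/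
def layer (n : ℕ) (T : ℝ) : Set (ℝ × Space n) := Ico 0 T ×ˢ univ

/-- The gradient `(∂ₜφ, ∇ₓφ)` of a function of `(t, x)` at the point `(t, x)`. -/
noncomputable def spaceTimeGradient {n : ℕ} (φ : ℝ × Space n → ℝ) (t : ℝ) (x : Space n) :
    ℝ × Space n :=
  (deriv (fun s => φ (s, x)) t, gradient (fun y => φ (t, y)) x)

/-- The superdifferential `D⁺u(t, x)`. -/
def superdifferential {n : ℕ} (u : ℝ → Space n → ℝ) (t : ℝ) (x : Space n) :
    Set (ℝ × Space n) :=
  {q | ∃ φ : ℝ × Space n → ℝ, ContDiffOn ℝ 1 φ (halfSpace n) ∧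
    IsLocalMaxOn (fun z => u z.1 z.2 - φ z) (halfSpace n) (t, x) ∧
    q = spaceTimeGradient φ t x}

/-- The subdifferential `D⁻u(t, x)`. -/
def subdifferential {n : ℕ} (u : ℝ → Space n → ℝ) (t : ℝ) (x : Space n) :
    Set (ℝ × Space n) :=
  {q | ∃ φ : ℝ × Space n → ℝ, ContDiffOn ℝ 1 φ (halfSpace n) ∧
    IsLocalMinOn (fun z => u z.1 z.2 - φ z) (halfSpace n) (t, x) ∧
    q = spaceTimeGradient φ t x}

/-- `BUC_loc`: continuous on `[0, ∞) × ℝⁿ`, bounded and uniformly continuous in every layer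
`[0, T) × ℝⁿ`. Only the values `u t x` with `0 ≤ t` matter. -/
def IsBUCLoc {n : ℕ} (u : ℝ → Space n → ℝ) : Prop :=
  ContinuousOn (fun z : ℝ × Space n => u z.1 z.2) (closedHalfSpace n) ∧
  ∀ T : ℝ, 0 < T →
    (∃ C : ℝ, ∀ z ∈ layer n T, |u z.1 z.2| ≤ C) ∧
    UniformContinuousOn (fun z : ℝ × Space n => u z.1 z.2) (layer n T)

/-- Viscosity subsolutions of `u_t + H(∇ₓu) = 0`, `u(0, x) = u₀(x)`. -/
def IsViscositySubsolution {n : ℕ} (H : Space n → ℝ) (u₀ : Space n → ℝ)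
    (u : ℝ → Space n → ℝ) : Prop :=
  IsBUCLoc u ∧ (∀ x, u 0 x ≤ u₀ x) ∧
  ∀ t : ℝ, 0 < t → ∀ x : Space n, ∀ q ∈ superdifferential u t x, q.1 + H q.2 ≤ 0

/-- Viscosity supersolutions of `u_t + H(∇ₓu) = 0`, `u(0, x) = u₀(x)`. -/
def IsViscositySupersolution {n : ℕ} (H : Space n → ℝ) (u₀ : Space n → ℝ)
    (u : ℝ → Space n → ℝ) : Prop :=
  IsBUCLoc u ∧ (∀ x, u₀ x ≤ u 0 x) ∧
  ∀ t : ℝ, 0 < t → ∀ x : Space n, ∀ q ∈ subdifferential u t x, 0 ≤ q.1 + H q.2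

/-- Viscosity solutions of `u_t + H(∇ₓu) = 0`, `u(0, x) = u₀(x)`. -/
def IsViscositySolution {n : ℕ} (H : Space n → ℝ) (u₀ : Space n → ℝ)
    (u : ℝ → Space n → ℝ) : Prop :=
  IsViscositySubsolution H u₀ u ∧ IsViscositySupersolution H u₀ u

/-! ### Bohr almost periodic functions -/

/-- The exponential `x ↦ exp(2πi ξ·x)`. -/
noncomputable def expFun {n : ℕ} (ξ x : Space n) : ℂ :=
  Complex.exp (((2 * Real.pi * inner ℝ ξ x : ℝ) : ℂ) * Complex.I)

/-- The exponential `x ↦ exp(2πi ξ·x)` as a bounded continuous function. -/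
noncomputable def expBCF {n : ℕ} (ξ : Space n) : Space n →ᵇ ℂ :=
  BoundedContinuousFunction.ofNormedAddCommGroup (expFun ξ)
    (by unfold expFun; fun_prop) 1
    (fun x => (Complex.norm_exp_ofReal_mul_I (2 * Real.pi * inner ℝ ξ x)).le)

/-- The space of trigonometric polynomials: finite sums `∑ a_ξ exp(2πi ξ·x)`. -/
noncomputable def trigPolynomials (n : ℕ) : Submodule ℂ (Space n →ᵇ ℂ) :=
  Submodule.span ℂ (range (expBCF (n := n)))

/-- `AP(ℝⁿ)`: the closure of the trigonometric polynomials in the uniform norm, with that norm. -/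
noncomputable def AP (n : ℕ) : Submodule ℂ (Space n →ᵇ ℂ) :=
  (trigPolynomials n).topologicalClosure

/-- A real function is Bohr almost periodic if it belongs to `AP(ℝⁿ)`. -/
def IsAlmostPeriodic {n : ℕ} (f : Space n → ℝ) : Prop :=
  ∃ g ∈ AP n, ∀ x, g x = (f x : ℂ)

/-- The cube `C_R` of side `R` centred at the origin. -/
def cube (n : ℕ) (R : ℝ) : Set (Space n) := {x | ∀ i, |x i| ≤ R / 2}

/-- `a` is the mean value of `f`, the limit of `R⁻ⁿ ∫_{C_R} f` as `R → ∞`. -/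
def HasMeanValue {n : ℕ} (f : Space n → ℂ) (a : ℂ) : Prop :=
  Tendsto (fun R : ℝ => ((R ^ n)⁻¹ : ℝ) • ∫ x in cube n R, f x) atTop (𝓝 a)

/-- `a` is the Bohr-Fourier coefficient of `f` at the frequency `ξ`. -/
def HasBohrFourierCoeff {n : ℕ} (f : Space n → ℝ) (ξ : Space n) (a : ℂ) : Prop :=
  HasMeanValue (fun x => (f x : ℂ) * expFun (-ξ) x) a

/-- The spectrum `Sp(f)`: the frequencies whose Bohr-Fourier coefficient is nonzero. -/
def spectrum {n : ℕ} (f : Space n → ℝ) : Set (Space n) :=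
  {ξ | ∃ a : ℂ, a ≠ 0 ∧ HasBohrFourierCoeff f ξ a}

end HamiltonJacobi

/-!
The solution inherits almost periodicity from its initial datum because the equation is invariant
under translations in `x` and obeys a comparison principle: `u(t, · + h)` solves the problem with
datum `u₀(· + h)`, so a translation that changes `u₀` by at most `δ` changes `u(t, ·)` by at most
`δ` (`IsViscositySolution.sub_le_of_translate`). The comparison principle
(`IsViscositySubsolution.le_add_of_supersolution`) is proved by doubling the variables; as `H` is
only continuous, the term that confines the maximum points is sent to zero after the steepness of
the coupling has been fixed, while the momenta stay in a compact set.

The passage from this domination to the spectrum does not use the general theory of almost periodic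
functions. By Fejér summation, `u₀` is a uniform limit of trigonometric polynomials with
frequencies in `Sp(u₀)` (`mem_closure_trigSpan_of_hasMeanValue`); the kernels are
`|A|⁻¹ |∑_{α ∈ A} e_α|²` for finite sets `A` of frequencies that are almost invariant under the
frequencies of a given polynomial. Let `P` be such an approximation with frequencies `ξ₁, …, ξₘ`.
Up to a small error, `u(t, ·)` is then Lipschitz with respect to the point `(e_{ξ₁}(x), …, e_{ξₘ}(x))`
of a torus, so McShane's formula makes it, up to that error, a continuous function on the torus
evaluated along `x`. Trigonometric polynomials are dense on the torus, and their pullbacks have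
frequencies in the group generated by the `ξᵢ` (`mem_closure_trigSpan_of_dominated`). Thus `u(t, ·)`
is a uniform limit of trigonometric polynomials with frequencies in `M₀`, and its coefficients
outside `M₀` vanish.
-/

namespace HamiltonJacobi

variable {n : ℕ}

/-! ### The comparison principle -/

/-- The test function of the doubling argument: a parabola of steepness `a` centred at `(s, y)`,
a time penalty `θ exp(K(τ - t₀))`, which is small at `t₀` and large at `t₀ + 1`, and a parabola
`β‖z‖²` that confines maximum points to a bounded set. -/
noncomputable def testFunction (a θ K t₀ β s : ℝ) (y : Space n) (z : ℝ × Space n) : ℝ :=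
  a * (z.1 - s) ^ 2 + a * ‖z.2 - y‖ ^ 2 + θ * Real.exp (K * (z.1 - t₀)) + β * ‖z.2‖ ^ 2

theorem contDiff_testFunction (a θ K t₀ β s : ℝ) (y : Space n) :
    ContDiff ℝ 1 (testFunction a θ K t₀ β s y) := by
  unfold testFunction
  have h1 : ContDiff ℝ 1 (fun z : ℝ × Space n => ‖z.2 - y‖ ^ 2) :=
    ContDiff.norm_sq ℝ (by fun_prop)
  have h2 : ContDiff ℝ 1 (fun z : ℝ × Space n => ‖z.2‖ ^ 2) :=
    ContDiff.norm_sq ℝ (by fun_prop)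
  fun_prop

theorem hasGradientAt_testFunction (a θ K t₀ β s t : ℝ) (x y : Space n) :
    HasGradientAt (fun z => testFunction a θ K t₀ β s y (t, z))
      ((2 * a) • (x - y) + (2 * β) • x) x := by
  rw [hasGradientAt_iff_hasFDerivAt]
  have h1 : HasFDerivAt (fun z : Space n => ‖z - y‖ ^ 2) _ x :=
    ((hasFDerivAt_id x).sub_const y).norm_sq
  have h2 : HasFDerivAt (fun z : Space n => ‖z‖ ^ 2) _ x := (hasFDerivAt_id x).norm_sq
  have h3 := ((h1.const_mul a).const_add (a * (t - s) ^ 2)).add_const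
    (θ * Real.exp (K * (t - t₀)))
  refine (h3.add (h2.const_mul β)).congr_fderiv ?_
  ext v
  simp
  ring

theorem hasDerivAt_testFunction (a θ K t₀ β s t : ℝ) (x y : Space n) :
    HasDerivAt (fun τ => testFunction a θ K t₀ β s y (τ, x))
      (2 * a * (t - s) + θ * K * Real.exp (K * (t - t₀))) t := by
  have h1 := (((hasDerivAt_id t).sub_const s).pow 2).const_mul a
  have h2 := ((((hasDerivAt_id t).sub_const t₀).const_mul K).exp).const_mul θ
  have h3 := ((h1.add_const (a * ‖x - y‖ ^ 2)).add h2).add_const (β * ‖x‖ ^ 2)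
  refine h3.congr_deriv ?_
  simp
  ring

theorem spaceTimeGradient_testFunction (a θ K t₀ β s t : ℝ) (x y : Space n) :
    spaceTimeGradient (testFunction a θ K t₀ β s y) t x =
      (2 * a * (t - s) + θ * K * Real.exp (K * (t - t₀)), (2 * a) • (x - y) + (2 * β) • x) :=
  Prod.ext (hasDerivAt_testFunction a θ K t₀ β s t x y).deriv
    (hasGradientAt_testFunction a θ K t₀ β s t x y).gradient

theorem spaceTimeGradient_neg (φ : ℝ × Space n → ℝ) (t : ℝ) (x : Space n) :
    spaceTimeGradient (fun z => -φ z) t x = -spaceTimeGradient φ t x := by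
  refine Prod.ext ?_ ?_
  · simp [spaceTimeGradient]
  · simp [spaceTimeGradient, gradient]

/-- The function maximised in the doubling argument. -/
noncomputable def doubling (u v : ℝ → Space n → ℝ) (a θ K t₀ β : ℝ)
    (z : (ℝ × Space n) × (ℝ × Space n)) : ℝ :=
  u z.1.1 z.1.2 - v z.2.1 z.2.2 - a * (z.1.1 - z.2.1) ^ 2 - a * ‖z.1.2 - z.2.2‖ ^ 2
    - θ * Real.exp (K * (z.1.1 - t₀)) - θ * Real.exp (K * (z.2.1 - t₀)) - β * ‖z.1.2‖ ^ 2

/-- The doubled function attains its maximum over times in `[0, T]`: in space it tends to `-∞`. -/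
theorem exists_isMaxOn_doubling {u v : ℝ → Space n → ℝ} {T C a θ K t₀ β : ℝ}
    (hu : ContinuousOn (fun z : ℝ × Space n => u z.1 z.2) (Ici 0 ×ˢ univ))
    (hv : ContinuousOn (fun z : ℝ × Space n => v z.1 z.2) (Ici 0 ×ˢ univ))
    (huC : ∀ t ∈ Icc 0 T, ∀ x, |u t x| ≤ C) (hvC : ∀ t ∈ Icc 0 T, ∀ x, |v t x| ≤ C)
    (ha : 0 < a) (hθ : 0 < θ) (hβ : 0 < β) (hT : 0 ≤ T) :
    ∃ z ∈ (Icc 0 T ×ˢ univ) ×ˢ (Icc 0 T ×ˢ univ),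
      IsMaxOn (doubling u v a θ K t₀ β) ((Icc 0 T ×ˢ univ) ×ˢ (Icc 0 T ×ˢ univ)) z := by
  set S : Set ((ℝ × Space n) × (ℝ × Space n)) := (Icc 0 T ×ˢ univ) ×ˢ (Icc 0 T ×ˢ univ) with hS
  have hcont : ContinuousOn (doubling u v a θ K t₀ β) S := by
    have h1 : ContinuousOn (fun z : (ℝ × Space n) × (ℝ × Space n) => u z.1.1 z.1.2) S :=
      hu.comp continuousOn_fst fun z hz => ⟨hz.1.1.1, trivial⟩
    have h2 : ContinuousOn (fun z : (ℝ × Space n) × (ℝ × Space n) => v z.2.1 z.2.2) S :=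
      hv.comp continuousOn_snd fun z hz => ⟨hz.2.1.1, trivial⟩
    unfold doubling
    refine ((((h1.sub h2).sub ?_).sub ?_).sub ?_ |>.sub ?_).sub ?_ <;>
      exact Continuous.continuousOn (by fun_prop)
  have hclosed : IsClosed S :=
    (isClosed_Icc.prod isClosed_univ).prod (isClosed_Icc.prod isClosed_univ)
  have h0 : (((0 : ℝ), (0 : Space n)), ((0 : ℝ), (0 : Space n))) ∈ S :=
    ⟨⟨⟨le_rfl, hT⟩, trivial⟩, ⟨⟨le_rfl, hT⟩, trivial⟩⟩
  refine hcont.exists_isMaxOn' hclosed h0 ?_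
  set w : (ℝ × Space n) × (ℝ × Space n) := (((0 : ℝ), (0 : Space n)), ((0 : ℝ), (0 : Space n)))
  set B : ℝ := 2 * C - doubling u v a θ K t₀ β w with hB
  have key : ∀ z ∈ S, doubling u v a θ K t₀ β w < doubling u v a θ K t₀ β z →
      z.1.2 ∈ Metric.closedBall 0 (√(B / β)) ∧
      z.2.2 ∈ Metric.closedBall 0 (√(B / β) + √(B / a)) := by
    intro z hz hlt
    have e1 := (abs_le.1 (huC _ hz.1.1 z.1.2)).2
    have e2 := (abs_le.1 (hvC _ hz.2.1 z.2.2)).1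
    have e3 : a * (z.1.1 - z.2.1) ^ 2 + a * ‖z.1.2 - z.2.2‖ ^ 2 + β * ‖z.1.2‖ ^ 2 ≤ B := by
      have p1 : 0 < θ * Real.exp (K * (z.1.1 - t₀)) := by positivity
      have p2 : 0 < θ * Real.exp (K * (z.2.1 - t₀)) := by positivity
      have e4 : doubling u v a θ K t₀ β z = u z.1.1 z.1.2 - v z.2.1 z.2.2
        - a * (z.1.1 - z.2.1) ^ 2 - a * ‖z.1.2 - z.2.2‖ ^ 2 - θ * Real.exp (K * (z.1.1 - t₀))
        - θ * Real.exp (K * (z.2.1 - t₀)) - β * ‖z.1.2‖ ^ 2 := rfl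
      linarith
    have q1 : 0 ≤ a * (z.1.1 - z.2.1) ^ 2 := by positivity
    have q2 : 0 ≤ a * ‖z.1.2 - z.2.2‖ ^ 2 := by positivity
    have q3 : 0 ≤ β * ‖z.1.2‖ ^ 2 := by positivity
    have r1 : ‖z.1.2‖ ≤ √(B / β) :=
      Real.le_sqrt_of_sq_le ((le_div_iff₀ hβ).2 (by linarith))
    have r2 : ‖z.1.2 - z.2.2‖ ≤ √(B / a) :=
      Real.le_sqrt_of_sq_le ((le_div_iff₀ ha).2 (by linarith))
    refine ⟨by simpa using r1, ?_⟩
    rw [mem_closedBall_zero_iff]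
    have : ‖z.2.2‖ ≤ ‖z.1.2‖ + ‖z.1.2 - z.2.2‖ := norm_le_insert _ _
    linarith
  rw [← Metric.cobounded_eq_cocompact, eventually_inf_principal]
  have hbdd : Bornology.IsBounded
      ((Icc 0 T ×ˢ Metric.closedBall (0 : Space n) (√(B / β))) ×ˢ
        (Icc 0 T ×ˢ Metric.closedBall (0 : Space n) (√(B / β) + √(B / a)))) :=
    ((Metric.isBounded_Icc 0 T).prod Metric.isBounded_closedBall).prod
      ((Metric.isBounded_Icc 0 T).prod Metric.isBounded_closedBall)
  filter_upwards [Bornology.isBounded_def.1 hbdd] with z hz hzS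
  by_contra hlt
  have := key z hzS (not_le.1 hlt)
  exact hz ⟨⟨hzS.1.1, this.1⟩, ⟨hzS.2.1, this.2⟩⟩

/-- At a maximum point of the doubled function with positive times, the two viscosity inequalities
combine into one from which the time derivative of the coupling has cancelled. -/
theorem hamiltonian_le_of_isMaxOn_doubling {H u₀ v₀ : Space n → ℝ} {u v : ℝ → Space n → ℝ}
    (hu : IsViscositySubsolution H u₀ u) (hv : IsViscositySupersolution H v₀ v)
    {a θ K t₀ β T t s : ℝ} {x y : Space n}
    (hmax : IsMaxOn (doubling u v a θ K t₀ β) ((Icc 0 T ×ˢ univ) ×ˢ (Icc 0 T ×ˢ univ))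
      ((t, x), (s, y))) (ht0 : 0 < t) (htT : t < T) (hs0 : 0 < s) (hsT : s < T) :
    θ * K * Real.exp (K * (t - t₀)) + θ * K * Real.exp (K * (s - t₀)) +
      H ((2 * a) • (x - y) + (2 * β) • x) ≤ H ((2 * a) • (x - y)) := by
  have ht : t ∈ Icc 0 T := ⟨ht0.le, htT.le⟩
  have hs : s ∈ Icc 0 T := ⟨hs0.le, hsT.le⟩
  have hsub := hu.2.2 t ht0 x _ ⟨testFunction a θ K t₀ β s y,
    (contDiff_testFunction a θ K t₀ β s y).contDiffOn, by
      have : ∀ᶠ z : ℝ × Space n in 𝓝[halfSpace n] (t, x), z.1 ∈ Ioo 0 T :=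
        (continuous_fst.tendsto' (t, x) t rfl).mono_left nhdsWithin_le_nhds
          |>.eventually (Ioo_mem_nhds ht0 htT)
      filter_upwards [this] with z hz
      have hz' := hmax (show (z, (s, y)) ∈ _ from
        ⟨⟨⟨hz.1.le, hz.2.le⟩, trivial⟩, ⟨hs, trivial⟩⟩)
      change doubling u v a θ K t₀ β _ ≤ doubling u v a θ K t₀ β _ at hz'
      change u z.1 z.2 - testFunction a θ K t₀ β s y z ≤ u t x - testFunction a θ K t₀ β s y (t, x)
      simp only [doubling] at hz'
      simp only [testFunction]
      linarith, rfl⟩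
  have hsup := hv.2.2 s hs0 y _ ⟨fun z => -testFunction a θ K t₀ 0 t x z,
    (contDiff_testFunction a θ K t₀ 0 t x).neg.contDiffOn, by
      have : ∀ᶠ z : ℝ × Space n in 𝓝[halfSpace n] (s, y), z.1 ∈ Ioo 0 T :=
        (continuous_fst.tendsto' (s, y) s rfl).mono_left nhdsWithin_le_nhds
          |>.eventually (Ioo_mem_nhds hs0 hsT)
      filter_upwards [this] with z hz
      have hz' := hmax (show ((t, x), z) ∈ _ from
        ⟨⟨ht, trivial⟩, ⟨⟨hz.1.le, hz.2.le⟩, trivial⟩⟩)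
      change doubling u v a θ K t₀ β _ ≤ doubling u v a θ K t₀ β _ at hz'
      change v s y - -testFunction a θ K t₀ 0 t x (s, y) ≤ v z.1 z.2 - -testFunction a θ K t₀ 0 t x z
      simp only [doubling] at hz'
      simp only [testFunction]
      have e1 : (z.1 - t) ^ 2 = (t - z.1) ^ 2 := by ring
      have e2 : (s - t) ^ 2 = (t - s) ^ 2 := by ring
      rw [norm_sub_rev z.2 x, norm_sub_rev y x, e1, e2]
      linarith, rfl⟩
  rw [spaceTimeGradient_testFunction] at hsub
  rw [spaceTimeGradient_neg, spaceTimeGradient_testFunction] at hsup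
  have hq : -((2 * a) • (y - x) + (2 * (0 : ℝ)) • y) = (2 * a) • (x - y) := by
    rw [mul_zero, zero_smul, add_zero, ← smul_neg, neg_sub]
  simp only [Prod.fst_neg, Prod.snd_neg, hq] at hsub hsup
  linarith

/-- Comparison: the order of initial data, up to a constant, is kept by viscosity sub- and
supersolutions. -/
theorem IsViscositySubsolution.le_add_of_supersolution {H u₀ v₀ : Space n → ℝ}
    (hH : Continuous H) {u v : ℝ → Space n → ℝ} (hu : IsViscositySubsolution H u₀ u)
    (hv : IsViscositySupersolution H v₀ v) {δ : ℝ} (h₀ : ∀ x, u₀ x ≤ v₀ x + δ)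
    {t₀ : ℝ} (ht₀ : 0 ≤ t₀) (x₀ : Space n) : u t₀ x₀ ≤ v t₀ x₀ + δ := by
  by_contra hcon
  -- Of the excess `8θ`, the penalties at `(t₀, x₀)` cost `3θ`, and replacing a nearby point costs `θ`.
  obtain ⟨θ, hθ, hgap⟩ : ∃ θ : ℝ, 0 < θ ∧ u t₀ x₀ = v t₀ x₀ + δ + 8 * θ :=
    ⟨(u t₀ x₀ - v t₀ x₀ - δ) / 8, by linarith, by ring⟩
  have h00 : ∀ x, u 0 x ≤ v 0 x + δ := fun x => by
    linarith [hu.2.1 x, hv.2.1 x, h₀ x]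
  obtain ⟨⟨C₁, hC₁⟩, huc⟩ := hu.1.2 (t₀ + 2) (by linarith)
  obtain ⟨⟨C₂, hC₂⟩, hvc⟩ := hv.1.2 (t₀ + 2) (by linarith)
  set T : ℝ := t₀ + 1 with hT
  obtain ⟨C, huC, hvC⟩ : ∃ C : ℝ, (∀ t ∈ Icc 0 T, ∀ x, |u t x| ≤ C) ∧
      (∀ t ∈ Icc 0 T, ∀ x, |v t x| ≤ C) :=
    ⟨max C₁ C₂, fun t ht x => (hC₁ (t, x) ⟨⟨ht.1, by simp only; linarith [ht.2]⟩, trivial⟩).trans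
      (le_max_left _ _), fun t ht x =>
      (hC₂ (t, x) ⟨⟨ht.1, by simp only; linarith [ht.2]⟩, trivial⟩).trans (le_max_right _ _)⟩
  have hC : 0 ≤ C := (abs_nonneg _).trans (huC 0 ⟨le_rfl, by linarith⟩ x₀)
  -- The time penalty exceeds every possible gain at time `t₀ + 1`.
  set K : ℝ := 4 * C / θ + 3 with hK
  have hK0 : 0 < K := by positivity
  have hexp : 4 * C + 3 * θ < θ * Real.exp K := by
    have e : θ * K = 4 * C + 3 * θ := by rw [hK]; field_simp
    rw [← e]
    gcongr
    linarith [Real.add_one_le_exp K]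
  set B : ℝ := 4 * C + 3 * θ with hB
  have hB0 : 0 < B := by positivity
  obtain ⟨ρ₁, hρ₁, hρu⟩ := Metric.uniformContinuousOn_iff.1 huc θ hθ
  obtain ⟨ρ₂, hρ₂, hρv⟩ := Metric.uniformContinuousOn_iff.1 hvc θ hθ
  obtain ⟨ρ, hρ, hρ₁', hρ₂'⟩ : ∃ ρ : ℝ, 0 < ρ ∧ ρ ≤ ρ₁ ∧ ρ ≤ ρ₂ :=
    ⟨min ρ₁ ρ₂, lt_min hρ₁ hρ₂, min_le_left _ _, min_le_right _ _⟩
  -- The steepness `a` forces the two points within `ρ` of each other.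
  set a : ℝ := (B + 1) / ρ ^ 2 with ha
  have ha0 : 0 < a := by positivity
  have haB : a * ρ ^ 2 = B + 1 := by rw [ha]; field_simp
  -- `c` is a lower bound for the slope of the time penalty: the gain that `H` has to absorb.
  set c : ℝ := θ * K * Real.exp (K * (0 - t₀)) with hc
  have hc0 : 0 < c := by positivity
  have hHu : UniformContinuousOn H (Metric.closedBall 0 (2 * a * ρ + 1)) :=
    (isCompact_closedBall _ _).uniformContinuousOn_of_continuous hH.continuousOn
  obtain ⟨κ', hκ', hκH'⟩ := Metric.uniformContinuousOn_iff.1 hHu c hc0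
  set κ : ℝ := min κ' 1 with hκ
  have hκ0 : 0 < κ := lt_min hκ' one_pos
  -- The confinement `β` is so small that its gradient is not seen by `H`.
  obtain ⟨β, hβ, hβx, hβκ⟩ : ∃ β : ℝ, 0 < β ∧ β * ‖x₀‖ ^ 2 ≤ θ ∧ 4 * β * B < κ ^ 2 := by
    refine ⟨min (θ / (‖x₀‖ ^ 2 + 1)) (κ ^ 2 / (4 * B + 1)), by positivity, ?_, ?_⟩
    · calc _ ≤ θ / (‖x₀‖ ^ 2 + 1) * ‖x₀‖ ^ 2 := by gcongr; exact min_le_left _ _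
        _ ≤ θ / (‖x₀‖ ^ 2 + 1) * (‖x₀‖ ^ 2 + 1) := by gcongr; linarith
        _ = θ := by field_simp
    · calc _ ≤ 4 * (κ ^ 2 / (4 * B + 1)) * B := by gcongr; exact min_le_right _ _
        _ < κ ^ 2 / (4 * B + 1) * (4 * B + 1) := by
          have : 0 < κ ^ 2 / (4 * B + 1) := by positivity
          linarith
        _ = κ ^ 2 := by field_simp
  obtain ⟨⟨⟨t, x⟩, ⟨s, y⟩⟩, ⟨⟨ht, -⟩, ⟨hs, -⟩⟩, hmax⟩ :=
    exists_isMaxOn_doubling (t₀ := t₀) (K := K) hu.1.1 hv.1.1 huC hvC ha0 hθ hβ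
      (by linarith : 0 ≤ T)
  simp only at ht hs
  set Φ := doubling u v a θ K t₀ β with hΦ
  have hΦ0 : δ + 5 * θ ≤ Φ ((t₀, x₀), (t₀, x₀)) := by
    simp only [hΦ, doubling, sub_self, mul_zero, Real.exp_zero, norm_zero]
    linarith
  have hle : Φ ((t₀, x₀), (t₀, x₀)) ≤ Φ ((t, x), (s, y)) :=
    hmax ⟨⟨⟨ht₀, by simp [hT]⟩, trivial⟩, ⟨⟨ht₀, by simp [hT]⟩, trivial⟩⟩
  have hΦ1 : -2 * C - 3 * θ ≤ Φ ((t₀, x₀), (t₀, x₀)) := by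
    simp only [hΦ, doubling, sub_self, mul_zero, Real.exp_zero, norm_zero]
    have e1 := (abs_le.1 (huC t₀ ⟨ht₀, by linarith⟩ x₀)).1
    have e2 := (abs_le.1 (hvC t₀ ⟨ht₀, by linarith⟩ x₀)).2
    linarith
  have hval : Φ ((t, x), (s, y)) = u t x - v s y - a * (t - s) ^ 2 - a * ‖x - y‖ ^ 2
    - θ * Real.exp (K * (t - t₀)) - θ * Real.exp (K * (s - t₀)) - β * ‖x‖ ^ 2 := rfl
  have hux := (abs_le.1 (huC t ht x)).2
  have hvy := (abs_le.1 (hvC s hs y)).1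
  have p1 : 0 < θ * Real.exp (K * (t - t₀)) := by positivity
  have p2 : 0 < θ * Real.exp (K * (s - t₀)) := by positivity
  have p3 : 0 ≤ a * (t - s) ^ 2 := by positivity
  have p4 : 0 ≤ a * ‖x - y‖ ^ 2 := by positivity
  have p5 : 0 ≤ β * ‖x‖ ^ 2 := by positivity
  have htT : t < T := by
    refine lt_of_le_of_ne ht.2 fun h => ?_
    have : K * (t - t₀) = K := by rw [h, hT]; ring
    rw [this] at hval
    linarith
  have hsT : s < T := by
    refine lt_of_le_of_ne hs.2 fun h => ?_
    have : K * (s - t₀) = K := by rw [h, hT]; ring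
    rw [this] at hval
    linarith
  have hts : |t - s| < ρ := by
    rw [← sq_lt_sq₀ (abs_nonneg _) hρ.le, sq_abs]
    by_contra hh
    have := mul_le_mul_of_nonneg_left (not_lt.1 hh) ha0.le
    linarith
  have hxy : ‖x - y‖ < ρ := by
    rw [← sq_lt_sq₀ (norm_nonneg _) hρ.le]
    by_contra hh
    have := mul_le_mul_of_nonneg_left (not_lt.1 hh) ha0.le
    linarith
  have hdist : dist (t, x) (s, y) < ρ := by
    rw [Prod.dist_eq, Real.dist_eq, dist_eq_norm]
    exact max_lt hts hxy
  have hlt : T < t₀ + 2 := by linarith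
  -- A maximum at an initial time would contradict the order of the initial data.
  have ht0 : 0 < t := by
    refine lt_of_le_of_ne ht.1 fun h => ?_
    subst h
    have := hρv (0, x) ⟨⟨le_rfl, ht.2.trans_lt hlt⟩, trivial⟩ (s, y)
      ⟨⟨hs.1, hs.2.trans_lt hlt⟩, trivial⟩
      (hdist.trans_le hρ₂')
    rw [Real.dist_eq] at this
    have h2 := (abs_lt.1 this).2
    have h3 := h00 x
    simp only at h2
    linarith
  have hs0 : 0 < s := by
    refine lt_of_le_of_ne hs.1 fun h => ?_
    subst h
    have := hρu (t, x) ⟨⟨ht.1, ht.2.trans_lt hlt⟩, trivial⟩ (0, y)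
      ⟨⟨le_rfl, hs.2.trans_lt hlt⟩, trivial⟩ (hdist.trans_le hρ₁')
    rw [Real.dist_eq] at this
    have h2 := (abs_lt.1 this).2
    have h3 := h00 y
    simp only at h2
    linarith
  have hfin := hamiltonian_le_of_isMaxOn_doubling hu hv hmax ht0 htT hs0 hsT
  have hp : ‖(2 * a) • (x - y)‖ ≤ 2 * a * ρ := by
    rw [norm_smul, Real.norm_of_nonneg (by positivity)]
    gcongr
  have hpx : ‖(2 * β) • x‖ < κ := by
    rw [← sq_lt_sq₀ (norm_nonneg _) hκ0.le, norm_smul, Real.norm_of_nonneg (by positivity)]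
    calc (2 * β * ‖x‖) ^ 2 = 4 * β * (β * ‖x‖ ^ 2) := by ring
      _ ≤ 4 * β * B := by gcongr; linarith
      _ < κ ^ 2 := hβκ
  have hHc := hκH' ((2 * a) • (x - y) + (2 * β) • x)
    (by
      rw [mem_closedBall_zero_iff]
      exact (norm_add_le _ _).trans (add_le_add hp (hpx.le.trans (min_le_right _ _))))
    ((2 * a) • (x - y)) (by rw [mem_closedBall_zero_iff]; linarith)
    (by rw [dist_eq_norm, add_sub_cancel_left]; exact hpx.trans_le (min_le_left _ _))
  rw [Real.dist_eq] at hHc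
  have h1 := (abs_lt.1 hHc).1
  have h2 : c ≤ θ * K * Real.exp (K * (t - t₀)) := by
    rw [hc]; gcongr
  have h3 : 0 ≤ θ * K * Real.exp (K * (s - t₀)) := by positivity
  linarith

/-! ### Exponentials and averages over cubes -/

@[simp]
theorem expBCF_apply (ξ x : Space n) : expBCF ξ x = expFun ξ x := rfl

theorem expFun_add (ξ η x : Space n) : expFun (ξ + η) x = expFun ξ x * expFun η x := by
  simp only [expFun, inner_add_left, ← Complex.exp_add]
  push_cast
  ring_nf

theorem expFun_add_right (ξ x y : Space n) : expFun ξ (x + y) = expFun ξ x * expFun ξ y := by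
  simp only [expFun, inner_add_right, ← Complex.exp_add]
  push_cast
  ring_nf

@[simp]
theorem expFun_zero (x : Space n) : expFun 0 x = 1 := by simp [expFun]

@[simp]
theorem norm_expFun (ξ x : Space n) : ‖expFun ξ x‖ = 1 :=
  Complex.norm_exp_ofReal_mul_I (2 * Real.pi * inner ℝ ξ x)

theorem star_expFun (ξ x : Space n) : star (expFun ξ x) = expFun (-ξ) x := by
  simp only [expFun, Complex.star_def, ← Complex.exp_conj, map_mul, Complex.conj_ofReal,
    Complex.conj_I, inner_neg_left]
  push_cast
  ring_nf

theorem expFun_neg_right (ξ x : Space n) : expFun ξ (-x) = expFun (-ξ) x := by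
  simp [expFun]

theorem expBCF_mul (ξ η : Space n) : expBCF ξ * expBCF η = expBCF (ξ + η) := by
  ext x
  simp [expFun_add]

theorem preimage_toLp_cube (R : ℝ) : (MeasurableEquiv.toLp 2 (Fin n → ℝ)) ⁻¹' (cube n R) =
    univ.pi fun _ => Icc (-(R / 2)) (R / 2) := by
  ext x
  simp only [cube, mem_preimage, mem_univ_pi, mem_Icc, ← abs_le]
  rfl

/-- Over the cube, the integral of a product of functions of single coordinates splits. -/
theorem setIntegral_cube_prod (R : ℝ) (f : Fin n → ℝ → ℂ) :
    ∫ x in cube n R, ∏ i, f i (x i) = ∏ i, ∫ t in Icc (-(R / 2)) (R / 2), f i t := by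
  rw [← (PiLp.volume_preserving_toLp (Fin n)).setIntegral_preimage_emb
    (MeasurableEquiv.toLp 2 (Fin n → ℝ)).measurableEmbedding (fun x => ∏ i, f i (x i))]
  change ∫ x in (MeasurableEquiv.toLp 2 (Fin n → ℝ)) ⁻¹' (cube n R), ∏ i, f i (x i) = _
  rw [preimage_toLp_cube, volume_pi, Measure.restrict_pi_pi]
  exact integral_fintype_prod_eq_prod (𝕜 := ℂ) f

theorem measurableSet_cube (R : ℝ) : MeasurableSet (cube n R) := by
  have : cube n R = ⋂ i, {x : Space n | |x i| ≤ R / 2} := by ext; simp [cube]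
  rw [this]
  exact MeasurableSet.iInter fun i => measurableSet_le (by fun_prop) measurable_const

theorem volume_cube (R : ℝ) : volume (cube n R) = ENNReal.ofReal R ^ n := by
  rw [← (PiLp.volume_preserving_toLp (Fin n)).measure_preimage
    (measurableSet_cube R).nullMeasurableSet]
  change volume ((MeasurableEquiv.toLp 2 (Fin n → ℝ)) ⁻¹' (cube n R)) = _
  rw [preimage_toLp_cube, volume_pi_pi]
  simp

theorem volume_cube_lt_top (R : ℝ) : volume (cube n R) < ⊤ := by
  rw [volume_cube]
  exact ENNReal.pow_lt_top ENNReal.ofReal_lt_top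

theorem integrableOn_cube (R : ℝ) (f : Space n →ᵇ ℂ) : IntegrableOn f (cube n R) := by
  have : IsFiniteMeasure (volume.restrict (cube n R)) := ⟨by simpa using volume_cube_lt_top R⟩
  exact f.integrable (volume.restrict (cube n R))

/-- The average over the cube of side `R`, as a linear functional. -/
noncomputable def cubeAverage (n : ℕ) (R : ℝ) : (Space n →ᵇ ℂ) →ₗ[ℂ] ℂ where
  toFun f := ((R ^ n)⁻¹ : ℝ) • ∫ x in cube n R, f x
  map_add' f g := by
    simp only [BoundedContinuousFunction.coe_add, Pi.add_apply]
    rw [integral_add (integrableOn_cube R f) (integrableOn_cube R g), smul_add]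
  map_smul' c f := by
    simp only [BoundedContinuousFunction.coe_smul, RingHom.id_apply]
    rw [integral_smul, smul_comm]

theorem hasMeanValue_iff (f : Space n →ᵇ ℂ) (a : ℂ) :
    HasMeanValue f a ↔ Tendsto (fun R => cubeAverage n R f) atTop (𝓝 a) := Iff.rfl

theorem norm_cubeAverage_le {R : ℝ} (hR : 0 < R) (f : Space n →ᵇ ℂ) :
    ‖cubeAverage n R f‖ ≤ ‖f‖ := by
  have h := norm_setIntegral_le_of_norm_le_const (volume_cube_lt_top (n := n) R)
    (fun x _ => f.norm_coe_le_norm x)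
  rw [measureReal_def, volume_cube, ENNReal.toReal_pow, ENNReal.toReal_ofReal hR.le] at h
  change ‖((R ^ n)⁻¹ : ℝ) • ∫ x in cube n R, f x‖ ≤ ‖f‖
  rw [norm_smul, Real.norm_of_nonneg (by positivity)]
  calc _ ≤ (R ^ n)⁻¹ * (‖f‖ * R ^ n) := by gcongr
    _ = ‖f‖ := by field_simp

/-- The mean of a product with a nonnegative factor `k` is at most the uniform norm times the mean
of `k`. -/
theorem norm_cubeAverage_mul_le (R : ℝ) (f k : Space n →ᵇ ℂ)
    (hk : ∀ x, k x = (‖k x‖ : ℂ)) :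
    ‖cubeAverage n R (f * k)‖ ≤ ‖f‖ * ‖cubeAverage n R k‖ := by
  change ‖((R ^ n)⁻¹ : ℝ) • ∫ x in cube n R, f x * k x‖ ≤
    ‖f‖ * ‖((R ^ n)⁻¹ : ℝ) • ∫ x in cube n R, k x‖
  have h1 : ‖∫ x in cube n R, f x * k x‖ ≤ ∫ x in cube n R, ‖f‖ * ‖k x‖ := by
    refine norm_integral_le_of_norm_le ((integrableOn_cube R k).norm.const_mul _)
      (Eventually.of_forall fun x => ?_)
    rw [norm_mul]
    gcongr
    exact f.norm_coe_le_norm x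
  have h2 : ∫ x in cube n R, k x = ((∫ x in cube n R, ‖k x‖ : ℝ) : ℂ) := by
    rw [← integral_complex_ofReal]
    exact integral_congr_ae (Eventually.of_forall fun x => hk x)
  have h3 : 0 ≤ ∫ x in cube n R, ‖k x‖ := integral_nonneg fun x => norm_nonneg _
  rw [h2, norm_smul, norm_smul, Complex.norm_of_nonneg h3]
  rw [integral_const_mul] at h1
  calc _ ≤ ‖((R ^ n)⁻¹ : ℝ)‖ * (‖f‖ * ∫ x in cube n R, ‖k x‖) := by gcongr
    _ = _ := by ring

theorem tendsto_average_exp (μ : ℝ) :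
    Tendsto (fun R : ℝ => (R⁻¹ : ℂ) *
      ∫ t in Icc (-(R / 2)) (R / 2), Complex.exp (2 * Real.pi * Complex.I * μ * t))
      atTop (𝓝 (if μ = 0 then 1 else 0)) := by
  split_ifs with h
  · refine tendsto_const_nhds.congr' ?_
    filter_upwards [eventually_gt_atTop 0] with R hR
    have : (R : ℂ) ≠ 0 := by exact_mod_cast hR.ne'
    simp only [h, Complex.ofReal_zero, mul_zero, zero_mul, Complex.exp_zero]
    rw [setIntegral_const]
    simp [hR.le, measureReal_def, this]
  · set c : ℂ := 2 * Real.pi * Complex.I * μ with hc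
    have hc0 : c ≠ 0 := by simp [hc, h]
    have hcre : ∀ t : ℝ, ‖Complex.exp (c * t)‖ = 1 := fun t => by
      rw [Complex.norm_exp]; simp [hc]
    have hb : ∀ᶠ R : ℝ in atTop, ‖(R⁻¹ : ℂ) * ∫ t in Icc (-(R / 2)) (R / 2), Complex.exp (c * t)‖
        ≤ R⁻¹ * (2 / ‖c‖) := by
      filter_upwards [eventually_gt_atTop 0] with R hR
      rw [integral_Icc_eq_integral_Ioc, ← intervalIntegral.integral_of_le (by linarith),
        integral_exp_mul_complex hc0, norm_mul, norm_div, norm_inv, Complex.norm_of_nonneg hR.le]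
      gcongr
      refine (norm_sub_le _ _).trans ?_
      rw [hcre, hcre]
      norm_num
    refine squeeze_zero_norm' hb ?_
    simpa using tendsto_inv_atTop_zero.mul_const (2 / ‖c‖)

theorem hasMeanValue_expBCF (μ : Space n) :
    HasMeanValue (expBCF μ) (if μ = 0 then 1 else 0) := by
  have h : ∀ R, cubeAverage n R (expBCF μ) = ∏ i, ((R⁻¹ : ℂ) *
      ∫ t in Icc (-(R / 2)) (R / 2), Complex.exp (2 * Real.pi * Complex.I * μ i * t)) := by
    intro R
    change ((R ^ n)⁻¹ : ℝ) • ∫ x in cube n R, expFun μ x = _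
    have : ∀ x : Space n, expFun μ x = ∏ i, Complex.exp (2 * Real.pi * Complex.I * μ i * x i) := by
      intro x
      rw [← Complex.exp_sum, expFun, PiLp.inner_apply]
      congr 1
      push_cast
      rw [Finset.mul_sum, Finset.sum_mul]
      refine Finset.sum_congr rfl fun i _ => ?_
      simp
      ring
    simp_rw [this]
    rw [setIntegral_cube_prod R fun i t => Complex.exp (2 * Real.pi * Complex.I * μ i * t),
      Finset.prod_mul_distrib]
    simp
  rw [hasMeanValue_iff]
  simp_rw [h]
  have hlim := tendsto_finsetProd (Finset.univ) fun (i : Fin n) _ => tendsto_average_exp (μ i)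
  refine hlim.trans_eq ?_
  congr 1
  by_cases hμ : μ = 0
  · simp [hμ]
  · obtain ⟨i, hi⟩ : ∃ i, μ i ≠ 0 := by
      by_contra hcon
      push Not at hcon
      exact hμ (by ext i; simpa using hcon i)
    rw [if_neg hμ]
    exact Finset.prod_eq_zero (Finset.mem_univ i) (by simp [hi])

/-! ### Bohr–Fourier coefficients -/

/-- The span of the exponentials with frequencies in `M`. -/
noncomputable def trigSpan (M : Set (Space n)) : Submodule ℂ (Space n →ᵇ ℂ) :=
  Submodule.span ℂ (expBCF '' M)

theorem trigSpan_univ : trigSpan (univ : Set (Space n)) = trigPolynomials n := by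
  rw [trigSpan, image_univ, trigPolynomials]

theorem topologicalClosure_trigSpan_le_AP (M : Set (Space n)) :
    (trigSpan M).topologicalClosure ≤ AP n := by
  refine Submodule.topologicalClosure_mono ?_
  rw [← trigSpan_univ]
  exact Submodule.span_mono (image_mono (subset_univ M))

/-- The Bohr–Fourier coefficient of a single exponential. -/
theorem hasMeanValue_expBCF_mul (μ ξ : Space n) :
    HasMeanValue (expBCF μ * expBCF (-ξ) : Space n →ᵇ ℂ) (if μ = ξ then 1 else 0) := by
  rw [expBCF_mul, ← sub_eq_add_neg]
  simpa [sub_eq_zero] using hasMeanValue_expBCF (μ - ξ)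

theorem HasMeanValue.add {f g : Space n →ᵇ ℂ} {a b : ℂ} (hf : HasMeanValue f a)
    (hg : HasMeanValue g b) : HasMeanValue (f + g : Space n →ᵇ ℂ) (a + b) := by
  rw [hasMeanValue_iff] at *
  simpa using hf.add hg

theorem HasMeanValue.sub {f g : Space n →ᵇ ℂ} {a b : ℂ} (hf : HasMeanValue f a)
    (hg : HasMeanValue g b) : HasMeanValue (f - g : Space n →ᵇ ℂ) (a - b) := by
  rw [hasMeanValue_iff] at *
  simpa using hf.sub hg

theorem HasMeanValue.const_smul {f : Space n →ᵇ ℂ} {a : ℂ} (c : ℂ) (hf : HasMeanValue f a) :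
    HasMeanValue (c • f : Space n →ᵇ ℂ) (c * a) := by
  rw [hasMeanValue_iff] at *
  simpa using hf.const_mul c

theorem HasMeanValue.sum {ι : Type*} (s : Finset ι) {f : ι → Space n →ᵇ ℂ} {a : ι → ℂ}
    (hf : ∀ i ∈ s, HasMeanValue (f i) (a i)) :
    HasMeanValue (∑ i ∈ s, f i : Space n →ᵇ ℂ) (∑ i ∈ s, a i) := by
  rw [hasMeanValue_iff]
  simp_rw [map_sum]
  exact tendsto_finsetSum s fun i hi => hf i hi

theorem HasMeanValue.norm_le {f : Space n →ᵇ ℂ} {a : ℂ} (hf : HasMeanValue f a) : ‖a‖ ≤ ‖f‖ := by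
  rw [hasMeanValue_iff] at hf
  refine le_of_tendsto hf.norm ?_
  filter_upwards [eventually_gt_atTop 0] with R hR using norm_cubeAverage_le hR f

/-- The mean value passes to uniform limits. -/
theorem exists_hasMeanValue_of_mem_closure {S : Submodule ℂ (Space n →ᵇ ℂ)}
    (hS : ∀ f ∈ S, ∃ a, HasMeanValue f a) {f : Space n →ᵇ ℂ} (hf : f ∈ S.topologicalClosure) :
    ∃ a, HasMeanValue f a := by
  refine cauchySeq_tendsto_of_complete (Metric.cauchySeq_iff.2 fun ε hε => ?_)
  obtain ⟨g, hgS, hg⟩ := Metric.mem_closure_iff.1 hf (ε / 3) (by positivity)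
  obtain ⟨a, ha⟩ := hS g hgS
  obtain ⟨N, hN⟩ := Metric.cauchySeq_iff.1 ((hasMeanValue_iff g a).1 ha).cauchySeq (ε / 3)
    (by positivity)
  have hfg : ∀ R : ℝ, 0 < R → dist (cubeAverage n R f) (cubeAverage n R g) < ε / 3 := by
    intro R hR
    rw [dist_eq_norm, ← map_sub]
    exact (norm_cubeAverage_le hR _).trans_lt (by rwa [← dist_eq_norm])
  refine ⟨max N 1, fun R hR R' hR' => ?_⟩
  have h1 := hfg R (by linarith [le_max_right N 1])
  have h2 := hfg R' (by linarith [le_max_right N 1])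
  have h3 := hN R ((le_max_left _ _).trans hR) R' ((le_max_left _ _).trans hR')
  rw [dist_comm] at h2
  have h4 := dist_triangle4 (cubeAverage n R f) (cubeAverage n R g) (cubeAverage n R' g)
    (cubeAverage n R' f)
  exact h4.trans_lt (by linarith)

theorem mul_expBCF_mem_trigPolynomials (ξ : Space n) {f : Space n →ᵇ ℂ}
    (hf : f ∈ trigPolynomials n) : f * expBCF ξ ∈ trigPolynomials n := by
  induction hf using Submodule.span_induction with
  | mem f hf =>
    obtain ⟨μ, rfl⟩ := hf
    rw [expBCF_mul]
    exact Submodule.subset_span ⟨_, rfl⟩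
  | zero => simp
  | add f g _ _ hf hg => rw [add_mul]; exact add_mem hf hg
  | smul c f _ hf => rw [smul_mul_assoc]; exact Submodule.smul_mem _ c hf

theorem exists_hasMeanValue_of_mem_trigPolynomials {f : Space n →ᵇ ℂ}
    (hf : f ∈ trigPolynomials n) : ∃ a, HasMeanValue f a := by
  induction hf using Submodule.span_induction with
  | mem f hf =>
    obtain ⟨μ, rfl⟩ := hf
    exact ⟨_, hasMeanValue_expBCF μ⟩
  | zero => exact ⟨0, by rw [hasMeanValue_iff]; simp⟩
  | add f g _ _ hf hg =>
    obtain ⟨a, ha⟩ := hf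
    obtain ⟨b, hb⟩ := hg
    exact ⟨_, ha.add hb⟩
  | smul c f _ hf =>
    obtain ⟨a, ha⟩ := hf
    exact ⟨_, ha.const_smul c⟩

/-- Every almost periodic function has Bohr–Fourier coefficients at all frequencies. -/
theorem exists_hasMeanValue_mul_expBCF {f : Space n →ᵇ ℂ} (hf : f ∈ AP n) (ξ : Space n) :
    ∃ a, HasMeanValue (f * expBCF (-ξ) : Space n →ᵇ ℂ) a := by
  refine exists_hasMeanValue_of_mem_closure
    (fun f hf => exists_hasMeanValue_of_mem_trigPolynomials hf) ?_
  refine map_mem_closure (f := fun g : Space n →ᵇ ℂ => g * expBCF (-ξ)) (by fun_prop) hf ?_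
  exact fun g hg => mul_expBCF_mem_trigPolynomials _ hg

theorem norm_mul_expBCF_le (f : Space n →ᵇ ℂ) (ξ : Space n) : ‖f * expBCF ξ‖ ≤ ‖f‖ :=
  (f * expBCF ξ).norm_le (norm_nonneg f) |>.2 fun x => by simpa using f.norm_coe_le_norm x

/-- A uniform limit of trigonometric polynomials with frequencies in `M` has vanishing coefficients
outside `M`. -/
theorem hasMeanValue_zero_of_mem_closure_trigSpan {M : Set (Space n)} {f : Space n →ᵇ ℂ}
    (hf : f ∈ (trigSpan M).topologicalClosure) {ξ : Space n} (hξ : ξ ∉ M) :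
    HasMeanValue (f * expBCF (-ξ) : Space n →ᵇ ℂ) 0 := by
  have hspan : ∀ g ∈ trigSpan M, HasMeanValue (g * expBCF (-ξ) : Space n →ᵇ ℂ) 0 := by
    intro g hg
    induction hg using Submodule.span_induction with
    | mem f hf =>
      obtain ⟨μ, hμ, rfl⟩ := hf
      have h := hasMeanValue_expBCF_mul μ ξ
      rwa [if_neg (by rintro rfl; exact hξ hμ)] at h
    | zero => rw [hasMeanValue_iff]; simp
    | add f g _ _ hf hg => rw [add_mul, ← add_zero (0 : ℂ)]; exact hf.add hg
    | smul c f _ hf => rw [smul_mul_assoc, ← mul_zero c]; exact hf.const_smul c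
  obtain ⟨a, ha⟩ := exists_hasMeanValue_mul_expBCF (topologicalClosure_trigSpan_le_AP M hf) ξ
  have ha0 : a = 0 := by
    rw [← norm_le_zero_iff]
    refine le_of_forall_pos_lt_add fun ε hε => ?_
    obtain ⟨g, hgS, hg⟩ := Metric.mem_closure_iff.1 hf ε hε
    have h := (ha.sub (hspan g hgS)).norm_le
    rw [sub_zero, ← sub_mul] at h
    rw [dist_eq_norm] at hg
    linarith [norm_mul_expBCF_le (f - g) (-ξ)]
  rwa [ha0] at ha

/-! ### Følner sets and Fejér kernels -/

/-- Finite subsets of an abelian group are almost invariant under suitable finite sets, because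
the boxes `∑ cₛ s`, `0 ≤ cₛ < k`, grow only polynomially in `k`. -/
theorem exists_almost_invariant_finset {G : Type*} [AddCommGroup G] [DecidableEq G]
    (F : Finset G) {η : ℝ} (hη : 0 < η) :
    ∃ A : Finset G, A.Nonempty ∧ ∀ g ∈ F,
      (1 - η) * A.card ≤ ((A ×ˢ A).filter fun p => p.1 - p.2 = g).card := by
  let B : ℕ → Finset G := fun k =>
    (Fintype.piFinset fun _ : F => Finset.range k).image fun c => ∑ s : F, c s • (s : G)
  have hmem : ∀ k x, x ∈ B k ↔ ∃ c : F → ℕ, (∀ s, c s < k) ∧ ∑ s : F, c s • (s : G) = x := by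
    intro k x
    simp [B]
  have hcard : ∀ k, (B k).card ≤ k ^ F.card := fun k =>
    Finset.card_image_le.trans (by simp)
  have hne : ∀ k, (B (k + 1)).Nonempty := fun k =>
    ⟨_, (hmem _ _).2 ⟨0, fun _ => Nat.succ_pos k, rfl⟩⟩
  have hsub : ∀ k, B k ⊆ B (k + 1) := fun k x hx => by
    obtain ⟨c, hc, h⟩ := (hmem _ _).1 hx
    exact (hmem _ _).2 ⟨c, fun s => (hc s).trans (Nat.lt_succ_self k), h⟩
  have hadd : ∀ k, ∀ g ∈ F, ∀ x ∈ B k, x + g ∈ B (k + 1) := fun k g hg x hx => by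
    obtain ⟨c, hc, h⟩ := (hmem _ _).1 hx
    refine (hmem _ _).2 ⟨c + Pi.single ⟨g, hg⟩ 1, fun s => ?_, ?_⟩
    · have := hc s
      by_cases hs : s = ⟨g, hg⟩
      · subst hs; simpa using this
      · simpa [hs] using this.trans (Nat.lt_succ_self k)
    · simp only [Pi.add_apply, add_smul, Finset.sum_add_distrib, h]
      rw [Finset.sum_eq_single ⟨g, hg⟩] <;> simp +contextual
  obtain ⟨k, hk⟩ : ∃ k, ((B (k + 2)).card : ℝ) ≤ (1 + η) * (B (k + 1)).card := by
    by_contra hcon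
    push Not at hcon
    have hgrow : ∀ k, (1 + η) ^ k ≤ (B (k + 1)).card := by
      intro k
      induction k with
      | zero => simpa using (hne 0).card_pos
      | succ k ih =>
        calc (1 + η) ^ (k + 1) = (1 + η) * (1 + η) ^ k := pow_succ' _ _
          _ ≤ (1 + η) * (B (k + 1)).card := by gcongr
          _ ≤ _ := (hcon k).le
    have hlim := (tendsto_add_atTop_iff_nat 1).2
      (tendsto_pow_const_div_const_pow_of_one_lt F.card (by linarith : 1 < 1 + η))
    have hη1 : 0 < (1 + η)⁻¹ := by positivity
    obtain ⟨k, hk⟩ := (hlim.eventually (gt_mem_nhds hη1)).exists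
    have h1 : (1 + η) ^ k ≤ ((k + 1 : ℕ) : ℝ) ^ F.card :=
      (hgrow k).trans (by exact_mod_cast hcard (k + 1))
    rw [div_lt_iff₀ (by positivity), pow_succ', inv_mul_cancel_left₀ (by positivity)] at hk
    linarith
  refine ⟨B (k + 1), hne k, fun g hg => ?_⟩
  set A := B (k + 1)
  have hinj : (A.filter fun x => x + g ∈ A).card ≤
      ((A ×ˢ A).filter fun p => p.1 - p.2 = g).card := by
    refine Finset.card_le_card_of_injOn (fun x => (x + g, x)) (fun x hx => ?_) ?_
    · simp only [Finset.coe_filter, mem_ofPred_eq] at hx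
      simp [hx.1, hx.2]
    · intro x _ y _ hxy
      exact (Prod.ext_iff.1 hxy).2
  have hout : (A.filter fun x => x + g ∉ A).card + A.card ≤ (B (k + 2)).card := by
    have h1 : (A.filter fun x => x + g ∉ A).card = ((A.filter fun x => x + g ∉ A).image
        fun x => x + g).card := (Finset.card_image_of_injective _ (add_left_injective g)).symm
    rw [h1, ← Finset.card_union_of_disjoint]
    · refine Finset.card_le_card (Finset.union_subset ?_ (hsub (k + 1)))
      intro y hy
      obtain ⟨x, hx, rfl⟩ := Finset.mem_image.1 hy
      exact hadd (k + 1) g hg x (Finset.mem_filter.1 hx).1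
    · rw [Finset.disjoint_left]
      intro y hy
      obtain ⟨x, hx, rfl⟩ := Finset.mem_image.1 hy
      exact (Finset.mem_filter.1 hx).2
  have hsplit := Finset.card_filter_add_card_filter_not (s := A) fun x => x + g ∈ A
  have e1 : ((A.filter fun x => x + g ∈ A).card : ℝ) ≤
      ((A ×ˢ A).filter fun p => p.1 - p.2 = g).card := by exact_mod_cast hinj
  have e2 : ((A.filter fun x => x + g ∉ A).card : ℝ) + A.card ≤ (B (k + 2)).card := by
    exact_mod_cast hout
  have e3 : ((A.filter fun x => x + g ∈ A).card : ℝ) + (A.filter fun x => x + g ∉ A).card =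
    A.card := by exact_mod_cast hsplit
  linarith

theorem card_filter_sub_eq_le {G : Type*} [AddCommGroup G] [DecidableEq G] (A : Finset G) (g : G) :
    ((A ×ˢ A).filter fun p => p.1 - p.2 = g).card ≤ A.card := by
  refine Finset.card_le_card_of_injOn Prod.fst (fun p hp => ?_) ?_
  · simp only [Finset.coe_filter, mem_ofPred_eq, Finset.mem_product] at hp
    exact hp.1.1
  · intro p hp q hq hpq
    simp only [Finset.coe_filter, mem_ofPred_eq] at hp hq
    refine Prod.ext hpq ?_
    have := hp.2.trans hq.2.symm
    rw [hpq] at this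
    exact sub_right_injective this

/-- The Fejér sum `|A|⁻¹ ∑_{α, β ∈ A} c(α - β) e_{α - β}` of coefficients `c`. -/
noncomputable def fejerSum (A : Finset (Space n)) (c : Space n → ℂ) : Space n →ᵇ ℂ :=
  (A.card : ℂ)⁻¹ • ∑ p ∈ A ×ˢ A, c (p.1 - p.2) • expBCF (p.1 - p.2)

theorem fejerSum_sub (A : Finset (Space n)) (c d : Space n → ℂ) :
    fejerSum A (fun ξ => c ξ - d ξ) = fejerSum A c - fejerSum A d := by
  simp only [fejerSum, sub_smul, Finset.sum_sub_distrib, smul_sub]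

theorem fejerSum_mem (A : Finset (Space n)) (c : Space n → ℂ) :
    fejerSum A c ∈ trigSpan {ξ | c ξ ≠ 0} := by
  refine Submodule.smul_mem _ _ (Submodule.sum_mem _ fun p _ => ?_)
  by_cases h : c (p.1 - p.2) = 0
  · simp [h]
  · exact Submodule.smul_mem _ _ (Submodule.subset_span ⟨_, h, rfl⟩)

/-- The Fejér kernel `y ↦ |A|⁻¹ |∑_{α ∈ A} e_α(x - y)|²`, expanded in exponentials. -/
noncomputable def fejerKernel (A : Finset (Space n)) (x : Space n) : Space n →ᵇ ℂ :=
  (A.card : ℂ)⁻¹ • ∑ p ∈ A ×ˢ A, expFun (p.1 - p.2) x • expBCF (-(p.1 - p.2))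

theorem fejerKernel_apply (A : Finset (Space n)) (x y : Space n) :
    fejerKernel A x y = (((A.card : ℝ)⁻¹ * ‖∑ α ∈ A, expFun α (x - y)‖ ^ 2 : ℝ) : ℂ) := by
  have h : ∀ α β : Space n, expFun (α - β) x * expFun (-(α - β)) y =
      expFun α (x - y) * star (expFun β (x - y)) := by
    intro α β
    rw [star_expFun, ← expFun_add, ← expFun_neg_right, ← expFun_add_right, sub_eq_add_neg,
      sub_eq_add_neg]
  push_cast
  rw [← Complex.mul_conj', map_sum, Finset.sum_mul_sum, ← Finset.sum_product']
  simp only [← Complex.star_def, ← h]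
  simp only [fejerKernel, BoundedContinuousFunction.coe_smul, BoundedContinuousFunction.coe_sum,
    Finset.sum_apply, expBCF_apply, smul_eq_mul]

theorem fejerKernel_eq_norm (A : Finset (Space n)) (x y : Space n) :
    fejerKernel A x y = (‖fejerKernel A x y‖ : ℂ) := by
  rw [fejerKernel_apply, Complex.norm_of_nonneg (by positivity)]

theorem hasMeanValue_fejerKernel {A : Finset (Space n)} (hA : A.Nonempty) (x : Space n) :
    HasMeanValue (fejerKernel A x) 1 := by
  have h : HasMeanValue (fejerKernel A x) ((A.card : ℂ)⁻¹ * ∑ p ∈ A ×ˢ A,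
      expFun (p.1 - p.2) x * if -(p.1 - p.2) = 0 then 1 else 0) :=
    (HasMeanValue.sum _ fun p _ => (hasMeanValue_expBCF _).const_smul _).const_smul _
  convert h using 1
  have hcard : (A.card : ℂ) ≠ 0 := by exact_mod_cast hA.card_pos.ne'
  have : ∀ p ∈ A ×ˢ A, (expFun (p.1 - p.2) x * if -(p.1 - p.2) = 0 then (1 : ℂ) else 0) =
      if p.1 = p.2 then 1 else 0 := by
    intro p _
    by_cases hp : p.1 = p.2
    · simp [hp]
    · simp [sub_eq_zero, hp, Ne.symm hp]
  rw [Finset.sum_congr rfl this, Finset.sum_product]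
  simp [hcard]

/-- Fejér summation does not increase the uniform norm: `fejerSum A c x` is the mean of `f` times
the Fejér kernel, which is nonnegative of mean `1`. -/
theorem norm_fejerSum_le {A : Finset (Space n)} (hA : A.Nonempty) {f : Space n →ᵇ ℂ}
    {c : Space n → ℂ} (hc : ∀ ξ, HasMeanValue (f * expBCF (-ξ) : Space n →ᵇ ℂ) (c ξ)) :
    ‖fejerSum A c‖ ≤ ‖f‖ := by
  refine (fejerSum A c).norm_le (norm_nonneg f) |>.2 fun x => ?_
  have h1 : HasMeanValue (f * fejerKernel A x : Space n →ᵇ ℂ) (fejerSum A c x) := by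
    have h : HasMeanValue ((A.card : ℂ)⁻¹ • ∑ p ∈ A ×ˢ A, expFun (p.1 - p.2) x •
        (f * expBCF (-(p.1 - p.2))) : Space n →ᵇ ℂ) ((A.card : ℂ)⁻¹ * ∑ p ∈ A ×ˢ A,
        expFun (p.1 - p.2) x * c (p.1 - p.2)) :=
      (HasMeanValue.sum _ fun p _ => (hc _).const_smul _).const_smul _
    convert h using 1
    · simp only [fejerKernel, mul_smul_comm, Finset.mul_sum]
    · simp [fejerSum, mul_comm]
  have h2 := hasMeanValue_fejerKernel hA x
  rw [hasMeanValue_iff] at h1 h2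
  have h3 := le_of_tendsto_of_tendsto' h1.norm (h2.norm.const_mul ‖f‖) fun R =>
    norm_cubeAverage_mul_le R f _ (fejerKernel_eq_norm A x)
  simpa using h3

theorem hasMeanValue_sum_smul_expBCF (a : Space n →₀ ℂ) (ξ : Space n) :
    HasMeanValue ((a.sum fun μ z => z • expBCF μ) * expBCF (-ξ) : Space n →ᵇ ℂ) (a ξ) := by
  classical
  have h : HasMeanValue (∑ μ ∈ a.support, a μ • (expBCF μ * expBCF (-ξ)) : Space n →ᵇ ℂ)
      (∑ μ ∈ a.support, a μ * if μ = ξ then 1 else 0) :=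
    HasMeanValue.sum _ fun μ _ => (hasMeanValue_expBCF_mul μ ξ).const_smul _
  convert h using 1
  · simp [Finsupp.sum, Finset.sum_mul]
  · simp +contextual [eq_comm]

/-- Fejér sums over almost invariant sets are close to the trigonometric polynomial itself. -/
theorem norm_fejerSum_finsupp_sub_le {A : Finset (Space n)} (hA : A.Nonempty)
    (a : Space n →₀ ℂ) {η : ℝ}
    (hη : ∀ μ ∈ a.support, (1 - η) * A.card ≤ ((A ×ˢ A).filter fun p => p.1 - p.2 = μ).card) :
    ‖fejerSum A a - a.sum fun μ z => z • expBCF μ‖ ≤ η * ∑ μ ∈ a.support, ‖a μ‖ := by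
  set r : Space n → ℕ := fun μ => ((A ×ˢ A).filter fun p => p.1 - p.2 = μ).card with hr
  have hcard : (0 : ℝ) < A.card := by exact_mod_cast hA.card_pos
  have h1 : ∑ p ∈ A ×ˢ A, a (p.1 - p.2) • expBCF (p.1 - p.2) =
      ∑ μ ∈ a.support, (r μ : ℂ) • (a μ • expBCF μ) := by
    have : ∀ p ∈ A ×ˢ A, a (p.1 - p.2) • expBCF (p.1 - p.2) =
        ∑ μ ∈ a.support, if p.1 - p.2 = μ then a μ • expBCF μ else 0 := by
      intro p _
      rw [Finset.sum_ite_eq]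
      split_ifs with h
      · rfl
      · rw [Finsupp.notMem_support_iff.1 h, zero_smul]
    rw [Finset.sum_congr rfl this, Finset.sum_comm]
    refine Finset.sum_congr rfl fun μ _ => ?_
    rw [← Finset.sum_filter, Finset.sum_const, hr, Nat.cast_smul_eq_nsmul]
  have h2 : fejerSum A a - (a.sum fun μ z => z • expBCF μ) =
      ∑ μ ∈ a.support, ((((r μ : ℝ) / A.card - 1 : ℝ) : ℂ) * a μ) • expBCF μ := by
    rw [fejerSum, h1, Finset.smul_sum, Finsupp.sum, ← Finset.sum_sub_distrib]
    refine Finset.sum_congr rfl fun μ _ => ?_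
    push_cast
    rw [← mul_smul, ← mul_smul, ← sub_smul]
    congr 1
    ring
  rw [h2, Finset.mul_sum]
  refine (norm_sum_le _ _).trans (Finset.sum_le_sum fun μ hμ => ?_)
  have he : ‖expBCF μ‖ ≤ 1 := (expBCF μ).norm_le zero_le_one |>.2 fun x => by simp
  have hle : (r μ : ℝ) ≤ A.card := by exact_mod_cast card_filter_sub_eq_le A μ
  have hge : (1 - η) * A.card ≤ (r μ : ℝ) := hη μ hμ
  have habs : |(r μ : ℝ) / A.card - 1| ≤ η := by
    have h3 : (r μ : ℝ) / A.card ≤ 1 := (div_le_one hcard).2 hle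
    have h4 : 1 - η ≤ (r μ : ℝ) / A.card := (le_div_iff₀ hcard).2 hge
    rw [abs_le]
    constructor <;> linarith
  rw [norm_smul, norm_mul, Complex.norm_real, Real.norm_eq_abs]
  have hη0 : 0 ≤ η := (abs_nonneg _).trans habs
  calc _ ≤ η * ‖a μ‖ * 1 := by gcongr
    _ = _ := mul_one _

/-- The approximation theorem: an almost periodic function is a uniform limit of trigonometric
polynomials with frequencies in its spectrum. -/
theorem mem_closure_trigSpan_of_hasMeanValue {f : Space n →ᵇ ℂ} (hf : f ∈ AP n) {c : Space n → ℂ}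
    (hc : ∀ ξ, HasMeanValue (f * expBCF (-ξ) : Space n →ᵇ ℂ) (c ξ)) :
    f ∈ (trigSpan {ξ | c ξ ≠ 0}).topologicalClosure := by
  classical
  refine Metric.mem_closure_iff.2 fun ε hε => ?_
  obtain ⟨P, hP, hfP⟩ := Metric.mem_closure_iff.1 hf (ε / 3) (by positivity)
  obtain ⟨a, rfl⟩ := Finsupp.mem_span_range_iff_exists_finsupp.1 hP
  set L : ℝ := ∑ μ ∈ a.support, ‖a μ‖ with hL
  have hL0 : 0 ≤ L := Finset.sum_nonneg fun _ _ => norm_nonneg _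
  obtain ⟨A, hA, hAη⟩ := exists_almost_invariant_finset a.support
    (η := ε / 3 / (L + 1)) (by positivity)
  refine ⟨fejerSum A c, fejerSum_mem A c, ?_⟩
  have h1 := norm_fejerSum_le hA (c := fun ξ => c ξ - a ξ) fun ξ => by
    have h := (hc ξ).sub (hasMeanValue_sum_smul_expBCF a ξ)
    rwa [← sub_mul] at h
  rw [fejerSum_sub] at h1
  have h2 := norm_fejerSum_finsupp_sub_le hA a (η := ε / 3 / (L + 1)) hAη
  have h3 : ε / 3 / (L + 1) * L ≤ ε / 3 := by
    rw [div_mul_eq_mul_div, div_le_iff₀ (by positivity)]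
    nlinarith
  rw [dist_eq_norm] at hfP ⊢
  set P := a.sum fun μ z => z • expBCF μ
  calc ‖f - fejerSum A c‖
      = ‖(f - P) - (fejerSum A c - fejerSum A a) - (fejerSum A a - P)‖ := by congr 1; abel
    _ ≤ ‖f - P‖ + ‖fejerSum A c - fejerSum A a‖ + ‖fejerSum A a - P‖ :=
      (norm_sub_le _ _).trans (add_le_add_left (norm_sub_le _ _) _)
    _ < ε := by linarith

/-! ### Functions dominated by an almost periodic function -/

/-- McShane extension along a map `j` into a metric space, for a function that is Lipschitz along
`j` up to an error `ε`. -/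
theorem exists_lipschitz_approx {E V : Type*} [Nonempty E] [PseudoMetricSpace V] {f : E → ℝ}
    {j : E → V} {ε L : ℝ} (hL : 0 ≤ L) (hf : ∀ x y, f x - f y ≤ ε + L * dist (j x) (j y)) :
    ∃ Φ : V → ℝ, Continuous Φ ∧ ∀ x, |Φ (j x) - f x| ≤ ε := by
  have e : E := Classical.arbitrary E
  have hbdd : ∀ z, BddBelow (range fun y => f y + L * dist z (j y)) := fun z => by
    refine ⟨f e - ε - L * dist (j e) z, ?_⟩
    rintro _ ⟨y, rfl⟩
    have h1 := hf e y
    have h2 := mul_le_mul_of_nonneg_left (dist_triangle (j e) z (j y)) hL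
    simp only
    linarith
  have hlip : ∀ z w, (⨅ y, f y + L * dist z (j y)) ≤ (⨅ y, f y + L * dist w (j y)) + L * dist z w :=
    fun z w => by
      rw [← sub_le_iff_le_add]
      refine le_ciInf fun y => ?_
      have h1 := ciInf_le (hbdd z) y
      have h2 := mul_le_mul_of_nonneg_left (dist_triangle z w (j y)) hL
      linarith
  refine ⟨fun z => ⨅ y, f y + L * dist z (j y), ?_, fun x => ?_⟩
  · refine (LipschitzWith.of_le_add_mul' L fun z w => hlip z w).continuous
  · have h1 : (⨅ y, f y + L * dist (j x) (j y)) ≤ f x := by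
      simpa using ciInf_le (hbdd (j x)) x
    have h2 : f x - ε ≤ ⨅ y, f y + L * dist (j x) (j y) := le_ciInf fun y => by
      linarith [hf x y]
    have h3 : 0 ≤ ε := by simpa using hf e e
    rw [abs_le]
    constructor <;> linarith

/-- The winding of `ℝⁿ` into the torus whose coordinates are the phases `ξ·x`, `ξ ∈ F`. -/
noncomputable def torusWinding (F : Finset (Space n)) (x : Space n) : UnitAddTorus F :=
  fun ξ => ((inner ℝ (ξ : Space n) x : ℝ) : UnitAddCircle)

theorem mFourier_torusWinding (F : Finset (Space n)) (k : F → ℤ) (x : Space n) :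
    UnitAddTorus.mFourier k (torusWinding F x) = expFun (∑ ξ : F, k ξ • (ξ : Space n)) x := by
  have h : UnitAddTorus.mFourier k (torusWinding F x) =
      ∏ ξ : F, fourier (k ξ) ((inner ℝ (ξ : Space n) x : ℝ) : UnitAddCircle) := rfl
  rw [h, expFun, sum_inner]
  simp_rw [fourier_coe_apply]
  rw [← Complex.exp_sum]
  congr 1
  push_cast
  rw [Finset.mul_sum, Finset.sum_mul]
  refine Finset.sum_congr rfl fun ξ _ => ?_
  rw [← Int.cast_smul_eq_zsmul ℝ, real_inner_smul_left]
  push_cast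
  ring

theorem fourier_one_torusWinding (F : Finset (Space n)) (ξ : F) (x : Space n) :
    fourier 1 (torusWinding F x ξ) = expFun (ξ : Space n) x := by
  rw [torusWinding, fourier_coe_apply, expFun]
  push_cast
  congr 1
  ring

/-- A continuous function on the torus, pulled back along the winding, is a uniform limit of
trigonometric polynomials with frequencies in the group generated by `F`. -/
theorem exists_trigSpan_approx_of_torus {M : AddSubgroup (Space n)} {F : Finset (Space n)}
    (hF : ∀ ξ ∈ F, ξ ∈ M) (Ψ : C(UnitAddTorus F, ℂ)) {ε : ℝ} (hε : 0 < ε) :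
    ∃ P ∈ trigSpan (M : Set (Space n)), ∀ x, ‖P x - Ψ (torusWinding F x)‖ ≤ ε := by
  have hΨ : Ψ ∈ (Submodule.span ℂ (range (UnitAddTorus.mFourier (d := F)))).topologicalClosure := by
    rw [UnitAddTorus.span_mFourier_closure_eq_top]
    trivial
  obtain ⟨Q, hQ, hd⟩ := Metric.mem_closure_iff.1 hΨ ε hε
  obtain ⟨P, hP, hPQ⟩ : ∃ P ∈ trigSpan (M : Set (Space n)), ∀ x, P x = Q (torusWinding F x) := by
    clear hd
    induction hQ using Submodule.span_induction with
    | mem Q hQ =>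
      obtain ⟨k, rfl⟩ := hQ
      refine ⟨expBCF (∑ ξ : F, k ξ • (ξ : Space n)), Submodule.subset_span ⟨_, ?_, rfl⟩,
        fun x => (mFourier_torusWinding F k x).symm⟩
      exact sum_mem fun ξ _ => zsmul_mem (hF ξ ξ.2) _
    | zero => exact ⟨0, zero_mem _, fun x => rfl⟩
    | add Q R _ _ hQ hR =>
      obtain ⟨P, hP, hPQ⟩ := hQ
      obtain ⟨P', hP', hPQ'⟩ := hR
      exact ⟨P + P', add_mem hP hP', fun x => by simp [hPQ, hPQ']⟩
    | smul c Q _ hQ =>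
      obtain ⟨P, hP, hPQ⟩ := hQ
      exact ⟨c • P, Submodule.smul_mem _ c hP, fun x => by simp [hPQ]⟩
  refine ⟨P, hP, fun x => ?_⟩
  rw [hPQ, ← dist_eq_norm, dist_comm]
  exact (ContinuousMap.dist_apply_le_dist _).trans hd.le

/-- If the translates of `f` vary at most as much as those of `g`, and `g` is a uniform limit of
trigonometric polynomials with frequencies in a group `M`, then so is `f`. -/
theorem mem_closure_trigSpan_of_dominated {M : AddSubgroup (Space n)} {f g : Space n →ᵇ ℂ}
    {f₀ : Space n → ℝ} (hf₀ : ∀ x, f x = (f₀ x : ℂ))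
    (hg : g ∈ (trigSpan (M : Set (Space n))).topologicalClosure)
    (hfg : ∀ (x y : Space n) (δ : ℝ), (∀ z, ‖g (x + z) - g (y + z)‖ ≤ δ) → f₀ x - f₀ y ≤ δ) :
    f ∈ (trigSpan (M : Set (Space n))).topologicalClosure := by
  refine Metric.mem_closure_iff.2 fun ε hε => ?_
  obtain ⟨P, hP, hgP⟩ := Metric.mem_closure_iff.1 hg (ε / 8) (by positivity)
  obtain ⟨a, haM, rfl⟩ := (Finsupp.mem_span_image_iff_linearCombination ℂ).1 hP
  set P := Finsupp.linearCombination ℂ expBCF a with hPdef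
  have hPx : ∀ x, P x = ∑ ξ : a.support, a ξ * expFun (ξ : Space n) x := by
    intro x
    rw [hPdef, Finsupp.linearCombination_apply, Finsupp.sum,
      ← Finset.sum_coe_sort a.support fun ξ => a ξ • expBCF ξ]
    simp
  set j : Space n → (a.support → ℂ) := fun x ξ => expFun (ξ : Space n) x with hj
  set L : ℝ := ∑ ξ : a.support, ‖a ξ‖ with hL
  have hL0 : 0 ≤ L := Finset.sum_nonneg fun _ _ => norm_nonneg _
  have hPlip : ∀ x y z, ‖P (x + z) - P (y + z)‖ ≤ L * dist (j x) (j y) := by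
    intro x y z
    rw [hPx, hPx, ← Finset.sum_sub_distrib, hL, Finset.sum_mul]
    refine (norm_sum_le _ _).trans (Finset.sum_le_sum fun ξ _ => ?_)
    rw [expFun_add_right, expFun_add_right, ← mul_sub, ← sub_mul, norm_mul, norm_mul, norm_expFun,
      mul_one, ← dist_eq_norm]
    gcongr
    exact dist_le_pi_dist (j x) (j y) ξ
  have hgPz : ∀ z, ‖g z - P z‖ ≤ ε / 8 := fun z => by
    rw [← dist_eq_norm]
    exact (BoundedContinuousFunction.dist_coe_le_dist z).trans hgP.le
  have hlip : ∀ x y, f₀ x - f₀ y ≤ ε / 4 + L * dist (j x) (j y) := by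
    intro x y
    refine hfg x y _ fun z => ?_
    calc ‖g (x + z) - g (y + z)‖
        = ‖(g (x + z) - P (x + z)) + (P (x + z) - P (y + z)) - (g (y + z) - P (y + z))‖ := by
          congr 1; ring
      _ ≤ ‖g (x + z) - P (x + z)‖ + ‖P (x + z) - P (y + z)‖ + ‖g (y + z) - P (y + z)‖ :=
          (norm_sub_le _ _).trans (add_le_add_left (norm_add_le _ _) _)
      _ ≤ _ := by linarith [hgPz (x + z), hgPz (y + z), hPlip x y z]
  obtain ⟨Φ, hΦ, hΦf⟩ := exists_lipschitz_approx hL0 hlip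
  let Ψ : C(UnitAddTorus a.support, ℂ) :=
    ⟨fun z => (Φ fun ξ => fourier 1 (z ξ) : ℝ), Complex.continuous_ofReal.comp
      (hΦ.comp (by fun_prop))⟩
  have hΨ : ∀ x, Ψ (torusWinding a.support x) = (Φ (j x) : ℂ) := fun x => by
    change ((Φ fun ξ => fourier 1 (torusWinding a.support x ξ) : ℝ) : ℂ) = _
    simp only [fourier_one_torusWinding, hj]
  obtain ⟨Q, hQ, hQΨ⟩ := exists_trigSpan_approx_of_torus (M := M) (F := a.support)
    (fun ξ hξ => haM hξ) Ψ (by positivity : 0 < ε / 4)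
  refine ⟨Q, hQ, lt_of_le_of_lt (b := ε / 2) ?_ (by linarith)⟩
  refine (BoundedContinuousFunction.dist_le (by positivity)).2 fun x => ?_
  have h1 := hQΨ x
  have h2 := hΦf x
  rw [hΨ, ← dist_eq_norm] at h1
  have h3 : dist (f x) (Φ (j x) : ℂ) ≤ ε / 4 := by
    rw [hf₀, dist_comm, dist_eq_norm, ← Complex.ofReal_sub, Complex.norm_real, Real.norm_eq_abs]
    exact h2
  have h4 := dist_triangle_right (f x) (Q x) (Φ (j x) : ℂ)
  linarith

/-! ### Viscosity solutions with almost periodic initial data -/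

theorem spaceTimeGradient_translate (φ : ℝ × Space n → ℝ) (h : Space n) (t : ℝ) (x : Space n) :
    spaceTimeGradient (fun z => φ (z.1, z.2 + h)) t x = spaceTimeGradient φ t (x + h) := by
  refine Prod.ext rfl ?_
  simp only [spaceTimeGradient, gradient]
  rw [fderiv_comp_add_right (f := fun y => φ (t, y))]

theorem IsBUCLoc.translate {u : ℝ → Space n → ℝ} (hu : IsBUCLoc u) (h : Space n) :
    IsBUCLoc fun t x => u t (x + h) := by
  have hcont : UniformContinuous fun z : ℝ × Space n => (z.1, z.2 + h) :=
    uniformContinuous_fst.prodMk (uniformContinuous_snd.add uniformContinuous_const)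
  refine ⟨hu.1.comp hcont.continuous.continuousOn fun z hz => ⟨hz.1, trivial⟩, fun T hT => ?_⟩
  obtain ⟨⟨C, hC⟩, huc⟩ := hu.2 T hT
  exact ⟨⟨C, fun z hz => hC (z.1, z.2 + h) ⟨hz.1, trivial⟩⟩,
    huc.comp hcont.uniformContinuousOn fun z hz => ⟨hz.1, trivial⟩⟩

theorem tendsto_translate (h : Space n) (t : ℝ) (x : Space n) :
    Tendsto (fun z : ℝ × Space n => (z.1, z.2 - h)) (𝓝[halfSpace n] (t, x))
      (𝓝[halfSpace n] (t, x - h)) := by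
  refine tendsto_nhdsWithin_of_tendsto_nhds_of_eventually_within _ ?_ ?_
  · exact ((by fun_prop : Continuous fun z : ℝ × Space n => (z.1, z.2 - h)).tendsto (t, x)).mono_left
      nhdsWithin_le_nhds
  · filter_upwards [self_mem_nhdsWithin] with z hz using ⟨hz.1, trivial⟩

theorem contDiffOn_translate {φ : ℝ × Space n → ℝ} (hφ : ContDiffOn ℝ 1 φ (halfSpace n))
    (h : Space n) : ContDiffOn ℝ 1 (fun z : ℝ × Space n => φ (z.1, z.2 + h)) (halfSpace n) :=
  hφ.comp (by fun_prop : ContDiff ℝ 1 fun z : ℝ × Space n => (z.1, z.2 + h)).contDiffOn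
    fun z hz => ⟨hz.1, trivial⟩

theorem IsViscositySubsolution.translate {H u₀ : Space n → ℝ} {u : ℝ → Space n → ℝ}
    (hu : IsViscositySubsolution H u₀ u) (h : Space n) :
    IsViscositySubsolution H (fun x => u₀ (x + h)) fun t x => u t (x + h) := by
  refine ⟨hu.1.translate h, fun x => hu.2.1 (x + h), fun t ht x q hq => ?_⟩
  obtain ⟨φ, hφ, hmax, rfl⟩ := hq
  refine hu.2.2 t ht (x + h) _ ⟨fun z => φ (z.1, z.2 + -h), contDiffOn_translate hφ (-h), ?_, ?_⟩
  · have := (tendsto_translate h t (x + h)).eventually (by rw [add_sub_cancel_right]; exact hmax)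
    simpa [IsLocalMaxOn, IsMaxFilter, sub_eq_add_neg] using this
  · rw [spaceTimeGradient_translate, add_neg_cancel_right]

/-- The solution varies along translations at most as much as its initial datum. -/
theorem IsViscositySolution.sub_le_of_translate {H u₀ : Space n → ℝ} (hH : Continuous H)
    {u : ℝ → Space n → ℝ} (hu : IsViscositySolution H u₀ u) {x y : Space n} {δ : ℝ}
    (hδ : ∀ z, u₀ (x + z) - u₀ (y + z) ≤ δ) {t : ℝ} (ht : 0 ≤ t) : u t x - u t y ≤ δ := by
  have h := (hu.1.translate (x - y)).le_add_of_supersolution hH hu.2 (δ := δ)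
    (fun z => by
      have := hδ (z - y)
      rw [add_sub_cancel] at this
      have e : x + (z - y) = z + (x - y) := by abel
      rw [e] at this
      linarith) ht y
  simp only [add_sub_cancel] at h
  linarith

/-- The value at time `t ≥ 0` of a function in `BUC_loc`, as a bounded continuous function. -/
noncomputable def timeSlice {u : ℝ → Space n → ℝ} (hu : IsBUCLoc u) (t : ℝ≥0) : Space n →ᵇ ℂ :=
  BoundedContinuousFunction.ofNormedAddCommGroup (fun x => (u t x : ℂ))
    (Complex.continuous_ofReal.comp <| continuousOn_univ.1 <|
      hu.1.comp (by fun_prop : Continuous fun x : Space n => ((t : ℝ), x)).continuousOn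
        fun _ _ => ⟨t.2, trivial⟩)
    (hu.2 (t + 1) (by positivity)).1.choose
    (fun x => by
      rw [Complex.norm_real]
      exact (hu.2 (t + 1) (by positivity)).1.choose_spec (t, x) ⟨⟨t.2, by simp⟩, trivial⟩)

@[simp]
theorem timeSlice_apply {u : ℝ → Space n → ℝ} (hu : IsBUCLoc u) (t : ℝ≥0) (x : Space n) :
    timeSlice hu t x = (u t x : ℂ) := rfl

theorem continuous_timeSlice {u : ℝ → Space n → ℝ} (hu : IsBUCLoc u) :
    Continuous (timeSlice hu) := by
  refine continuous_iff_continuousAt.2 fun t => Metric.continuousAt_iff.2 fun ε hε => ?_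
  obtain ⟨ρ, hρ, h⟩ := Metric.uniformContinuousOn_iff.1 (hu.2 (t + 1) (by positivity)).2 (ε / 2)
    (by positivity)
  refine ⟨min ρ 1, by positivity, fun {s} hs => lt_of_le_of_lt (b := ε / 2) ?_ (by linarith)⟩
  refine (BoundedContinuousFunction.dist_le (by positivity)).2 fun x => ?_
  have hs1 : (s : ℝ) < t + 1 := by
    have := (abs_lt.1 ((NNReal.dist_eq s t).symm.trans_lt (hs.trans_le (min_le_right _ _)))).2
    linarith
  rw [timeSlice_apply, timeSlice_apply, Complex.isometry_ofReal.dist_eq]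
  exact (h (s, x) ⟨⟨s.2, hs1⟩, trivial⟩ (t, x) ⟨⟨t.2, by simp⟩, trivial⟩ (by
    rw [Prod.dist_eq, dist_self]
    exact max_lt (hs.trans_le (min_le_left _ _)) hρ)).le

/-- The approximation theorem for the spectrum of a real almost periodic function. -/
theorem mem_closure_trigSpan_spectrum {f : Space n → ℝ} {g : Space n →ᵇ ℂ} (hg : g ∈ AP n)
    (hgf : ∀ x, g x = (f x : ℂ)) : g ∈ (trigSpan (spectrum f)).topologicalClosure := by
  choose c hc using exists_hasMeanValue_mul_expBCF hg
  refine Submodule.topologicalClosure_mono (Submodule.span_mono (image_mono fun ξ hξ => ?_))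
    (mem_closure_trigSpan_of_hasMeanValue hg hc)
  refine ⟨c ξ, hξ, ?_⟩
  have h := hc ξ
  simpa only [HasBohrFourierCoeff, BoundedContinuousFunction.coe_mul, Pi.mul_def, expBCF_apply, hgf]
    using h

theorem spectrum_subset_of_mem_closure_trigSpan {f : Space n → ℝ} {g : Space n →ᵇ ℂ}
    (hgf : ∀ x, g x = (f x : ℂ)) {M : Set (Space n)}
    (hg : g ∈ (trigSpan M).topologicalClosure) : spectrum f ⊆ M := by
  rintro ξ ⟨a, ha, hfa⟩
  by_contra hξ
  have h := hasMeanValue_zero_of_mem_closure_trigSpan hg hξ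
  refine ha (tendsto_nhds_unique hfa ?_)
  simpa only [HasMeanValue, BoundedContinuousFunction.coe_mul, Pi.mul_def, expBCF_apply, hgf]
    using h

/-- At every time the solution is a uniform limit of trigonometric polynomials with frequencies in
the group generated by the spectrum of the initial datum. -/
theorem IsViscositySolution.timeSlice_mem {H u₀ : Space n → ℝ} (hH : Continuous H)
    (hu₀ : IsAlmostPeriodic u₀) {u : ℝ → Space n → ℝ} (hu : IsViscositySolution H u₀ u)
    (t : ℝ≥0) : timeSlice hu.1.1 t ∈
      (trigSpan (AddSubgroup.closure (spectrum u₀) : Set (Space n))).topologicalClosure := by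
  obtain ⟨g, hg, hgu⟩ := hu₀
  have hgM : g ∈ (trigSpan (AddSubgroup.closure (spectrum u₀) : Set (Space n))).topologicalClosure :=
    Submodule.topologicalClosure_mono
      (Submodule.span_mono (image_mono AddSubgroup.subset_closure))
      (mem_closure_trigSpan_spectrum hg hgu)
  refine mem_closure_trigSpan_of_dominated (timeSlice_apply hu.1.1 t) hgM fun x y δ hδ => ?_
  refine hu.sub_le_of_translate hH (fun z => ?_) t.2
  have h := hδ z
  rw [hgu, hgu, ← Complex.ofReal_sub, Complex.norm_real] at h
  exact (le_abs_self _).trans h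

end HamiltonJacobi

theorem theorem2 (n : ℕ)
    (H : HamiltonJacobi.Space n → ℝ) (hH : Continuous H)
    (u₀ : HamiltonJacobi.Space n → ℝ) (hu₀ : HamiltonJacobi.IsAlmostPeriodic u₀)
    (u : ℝ → HamiltonJacobi.Space n → ℝ)
    (hu : HamiltonJacobi.IsViscositySolution H u₀ u) :
    (∃ U : C(ℝ≥0, HamiltonJacobi.AP n), ∀ (t : ℝ≥0) (x : HamiltonJacobi.Space n),
      (U t : HamiltonJacobi.Space n →ᵇ ℂ) x = (u t x : ℂ)) ∧
    ∀ t : ℝ, 0 < t →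
      HamiltonJacobi.spectrum (u t) ⊆
        (AddSubgroup.closure (HamiltonJacobi.spectrum u₀) : Set (HamiltonJacobi.Space n)) := by
  refine ⟨⟨⟨fun t => ⟨HamiltonJacobi.timeSlice hu.1.1 t,
    HamiltonJacobi.topologicalClosure_trigSpan_le_AP _ (hu.timeSlice_mem hH hu₀ t)⟩,
    (HamiltonJacobi.continuous_timeSlice hu.1.1).subtype_mk _⟩, fun t x => rfl⟩, fun t ht => ?_⟩
  exact HamiltonJacobi.spectrum_subset_of_mem_closure_trigSpan
    (HamiltonJacobi.timeSlice_apply hu.1.1 ⟨t, ht.le⟩) (hu.timeSlice_mem hH hu₀ ⟨t, ht.le⟩)
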